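/- Let $N\ge 0$ be an integer and $\delta\in\mathbb C$. For $m\equiv n \pmod 2$ an affine diagram from $m$ to $n$ is a homotopy class of pictures on a vertical cylinder with $n$ marked points on the top circle and $m$ marked points on the bottom circle, in which the marked points are joined pairwise by non-intersecting arcs, and which may also contain finitely many circles around the cylinder disjoint from each other and from the arcs. For affine diagrams $\alpha$ from $m$ to $n$ and $\beta$ from $k$ to $m$ let $\alpha\circ\beta$ be the affine diagram from $k$ to $n$ obtained by gluing the bottom of $\alpha$ to the top of $\beta$ and removing the contractible loops, let $m(\alpha,\beta)$ be the number of these loops, and put $\alpha\beta=\delta^{m(\alpha,\beta)}\,\alpha\circ\beta$. The algebra $T_N(\delta)$ has as $\mathbb C$-basis the affine diagrams from $N$ to $N$, with this product extended bilinearly. Number the marked points of each circle from a vertical cut of the cylinder onwards. For $k>0$ let the twist $\tau_k$ be the diagram from $k$ to $k$ joining the $i$-th bottom point to the $(i+1)$-st top point for $i<k$ and the $k$-th bottom point, across the cut, to the first top point; let $\tau_0$ be the diagram from $0$ to $0$ consisting of one circle around the cylinder. A diagram is monic if no arc joins two bottom points. A monic diagram is standard if it has no circles and its arcs joining the bottom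 to the top can be drawn without meeting the cut. Let $\mathcal T_N=\{k\in\mathbb Z: 0\le k\le N,\ k\equiv N \pmod 2\}$, and for $k\in\mathcal T_N$ let $d_k$ be the number of standard diagrams from $k$ to $N$ (it is finite). Let $M_k$ be the free right $\mathbb C[x,x^{-1}]$-module with the standard diagrams from $k$ to $N$ as basis. A diagram $\chi$ from $k$ to $N$ is regarded as an element of $M_k$ as follows. If $k>0$, then $\chi=\gamma x^r$ when $\chi=\gamma\circ\tau_k^r$ with $\gamma$ standard and $r\in\mathbb Z$, and $\chi=0$ when $\chi$ is not monic. If $k=0$, then $\chi=\gamma\,(x+x^{-1})^r$ when $\chi=\gamma\circ\tau_0^r$ with $\gamma$ standard and $r\ge 0$. With these identifications $T_N(\delta)$ acts $\mathbb C[x,x^{-1}]$-linearly on $M_k$ from the left by $\alpha\cdot\beta=\delta^{m(\alpha,\beta)}\,\alpha\circ\beta$ ($\alpha$ an affine diagram from $N$ to $N$, $\beta$ a standard diagram from $k$ to $N$). Taking the matrices of this action in the bases of standard diagrams for all $k$, one maps $T_N(\delta)$ into $\prod_{k\in\mathcal T_N}\mathrm{Mat}_{d_k}(\mathbb C[x,x^{-1}])$.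 **Proposition.** The commutant of (the image of) $T_N(\delta)$ in $\prod_{k\in\mathcal T_N}\mathrm{Mat}_{d_k}(\mathbb C[x,x^{-1}])$ is $\prod_{k\in\mathcal T_N}\mathbb C[x,x^{-1}]$, embedded (injectively) as the set of families of matrices that are scalar in each component $k$. -/

import Mathlib

open scoped LaurentPolynomial

namespace AffineTL

/-! ### Diagrams on the cylinder, described on the universal cover of the cylinder

The universal cover of the cylinder is an infinite horizontal strip.  A boundary circle with `n`
marked points lifts to a line whose marked points are the pairs `(i, t)`: the point number `i` in
the `t`-th copy of the fundamental domain (the domain between two consecutive lifts of the cut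
`l`).  From left to right these points sit at the integer positions `t * n + i`. -/

/-- Lifts of the marked points of a boundary circle with `n` marked points. -/
abbrev Pt (n : ℕ) : Type := Fin n × ℤ

/-- The position of a lifted marked point on its line. -/
def pos {n : ℕ} (p : Pt n) : ℤ := p.2 * n + p.1.val

/-- The deck transformation by `t` turns. -/
def sh {n : ℕ} (t : ℤ) (p : Pt n) : Pt n := (p.1, p.2 + t)

/-- Lifted marked points of a cylinder with `n` points on the top circle (`Sum.inl`) and `m` points
on the bottom circle (`Sum.inr`). -/
abbrev Ends (m n : ℕ) : Type := Pt n ⊕ Pt m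

/-- The deck transformation by `t` turns, on the ends of a cylinder. -/
def shE {m n : ℕ} (t : ℤ) : Ends m n → Ends m n := Sum.map (sh t) (sh t)

/-- A pairwise joining by arcs of the `m` bottom and `n` top marked points of a cylinder, each arc
being known up to homotopy, together with a number of circles going around the cylinder.  No
planarity is imposed here, see `IsAffine`.  The arcs are recorded through their lifts to the
strip: `arc p` is the other end of the lifted arc that starts at `p`. -/
@[ext]
structure Diagram (m n : ℕ) where
  arc : Ends m n → Ends m n
  arc_arc : ∀ p, arc (arc p) = p
  arc_ne : ∀ p, arc p ≠ p
  arc_sh : ∀ t p, arc (shE t p) = shE t (arc p)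
  circles : ℕ

/-- The order of the lifted marked points along the boundary of the strip: first the top line from
left to right, then the bottom line from right to left. -/
def Before {m n : ℕ} : Ends m n → Ends m n → Prop
  | .inl p, .inl q => pos p < pos q
  | .inl _, .inr _ => True
  | .inr _, .inl _ => False
  | .inr p, .inr q => pos q < pos p

/-- `α` can be drawn on the cylinder without intersections: no two lifted arcs are interlaced on
the boundary of the strip, and circles around the cylinder occur only if no arc joins the top to
the bottom.  The diagrams with this property are the (homotopy classes of) affine diagrams
from `m` to `n`. -/
def IsAffine {m n : ℕ} (α : Diagram m n) : Prop :=
  (¬ ∃ p q, Before p q ∧ Before q (α.arc p) ∧ Before (α.arc p) (α.arc q)) ∧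
  (0 < α.circles → ∀ p q, α.arc (.inl p) ≠ .inr q)

/-! ### Gluing -/

/-- Lifted marked points of two cylinders glued one on top of the other: the `n` points of the top
circle, the `m` points of the common circle, the `k` points of the bottom circle. -/
abbrev Glued (k m n : ℕ) : Type := Pt n ⊕ (Pt m ⊕ Pt k)

section Gluing

variable {k m n : ℕ}

/-- The deck transformation by `t` turns, on the glued cylinder. -/
def shG (t : ℤ) : Glued k m n → Glued k m n := Sum.map (sh t) (Sum.map (sh t) (sh t))

/-- The ends of the upper cylinder inside the glued one. -/
def upperEnds : Ends m n → Glued k m n := Sum.map id Sum.inl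

/-- The ends of the glued cylinder. -/
def outer : Ends k n → Glued k m n := Sum.map id Sum.inr

/-- A lifted marked point of the common circle. -/
def seam (p : Pt m) : Glued k m n := Sum.inr (Sum.inl p)

/-- Travel along the arcs of the upper diagram (points outside the upper cylinder stay). -/
def upperStep (α : Diagram m n) : Glued k m n → Glued k m n
  | .inl p => upperEnds (α.arc (.inl p))
  | .inr (.inl p) => upperEnds (α.arc (.inr p))
  | .inr (.inr p) => .inr (.inr p)

/-- Travel along the arcs of the lower diagram (points outside the lower cylinder stay). -/
def lowerStep (β : Diagram k m) : Glued k m n → Glued k m n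
  | .inl p => .inl p
  | .inr p => .inr (β.arc p)

/-- Two lifted marked points lie on the same curve of the glued strip. -/
def Conn (α : Diagram m n) (β : Diagram k m) : Glued k m n → Glued k m n → Prop :=
  Relation.EqvGen fun x y => y = upperStep α x ∨ y = lowerStep β x

/-! #### Each curve with an end on the boundary has exactly two ends -/

theorem two_involutions {X : Type*} (a b : X → X) (ha : ∀ x, a (a x) = x) (hb : ∀ x, b (b x) = x)
    (p : X) (hbp : b p = p) (hap : a p ≠ p)
    (hper : ∃ L : ℕ, 0 < L ∧ b ((fun x => b (a x))^[L] p) = (fun x => b (a x))^[L] p) :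
    ∃! q, (q ≠ p ∧ Relation.EqvGen (fun x y => y = a x ∨ y = b x) p q) ∧
      (a q = q ∨ b q = q) := by
  let g : Equiv.Perm X := ⟨fun x => b (a x), fun x => a (b x), fun x => by simp [ha, hb],
    fun x => by simp [ha, hb]⟩
  have g_app : ∀ x, g x = b (a x) := fun _ => rfl
  have gi_app : ∀ x, g⁻¹ x = a (b x) := fun _ => rfl
  have hbg : ∀ (j : ℤ) x, b ((g ^ j) x) = (g ^ (-j)) (b x) := by
    intro j
    induction j using Int.induction_on with
    | zero => intro x; simp
    | succ i ih =>
      intro x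
      rw [zpow_add_one, Equiv.Perm.mul_apply, ih, neg_add, zpow_add, Equiv.Perm.mul_apply,
        zpow_neg_one, gi_app, g_app, hb, hb]
    | pred i ih =>
      intro x
      rw [zpow_sub_one, Equiv.Perm.mul_apply, ih, neg_sub, sub_neg_eq_add, neg_neg, gi_app,
        add_comm, zpow_add_one, Equiv.Perm.mul_apply, g_app]
  have hag : ∀ (j : ℤ) x, a ((g ^ j) x) = (g ^ (-j)) (a x) := by
    intro j x
    have h1 : ∀ y, a y = g⁻¹ (b y) := fun y => by rw [gi_app, hb]
    rw [h1, hbg, h1 x, ← Equiv.Perm.mul_apply, ← Equiv.Perm.mul_apply, ← zpow_neg_one, ← zpow_add,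
      ← zpow_add, add_comm]
  have hagp : ∀ j : ℤ, a ((g ^ j) p) = (g ^ (-j - 1)) p := by
    intro j
    rw [hag, zpow_sub_one, Equiv.Perm.mul_apply, gi_app, hbp]
  have hbgp : ∀ j : ℤ, b ((g ^ j) p) = (g ^ (-j)) p := by
    intro j
    rw [hbg, hbp]
  have hcomp : ∀ x y, Relation.EqvGen (fun x y => y = a x ∨ y = b x) x y →
      ((∃ j : ℤ, x = (g ^ j) p) ↔ ∃ j : ℤ, y = (g ^ j) p) := by
    intro x y h
    induction h with
    | rel x y h =>
      rcases h with rfl | rfl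
      · constructor
        · rintro ⟨j, rfl⟩; exact ⟨_, hagp j⟩
        · rintro ⟨j, hj⟩; exact ⟨-j - 1, by rw [← hagp, ← hj, ha]⟩
      · constructor
        · rintro ⟨j, rfl⟩; exact ⟨_, hbgp j⟩
        · rintro ⟨j, hj⟩; exact ⟨-j, by rw [← hbgp, ← hj, hb]⟩
    | refl x => exact Iff.rfl
    | symm x y _ ih => exact ih.symm
    | trans x y z _ _ ih1 ih2 => exact ih1.trans ih2
  have hreach : ∀ j : ℕ, Relation.EqvGen (fun x y => y = a x ∨ y = b x) p ((g ^ (j : ℤ)) p) := by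
    intro j
    induction j with
    | zero => exact .refl _
    | succ j ih =>
      refine ih.trans _ _ _ ((Relation.EqvGen.rel _ (a ((g ^ (j : ℤ)) p)) (Or.inl rfl)).trans _ _ _
        (.rel _ _ (Or.inr ?_)))
      rw [Nat.cast_succ, add_comm, zpow_one_add, Equiv.Perm.mul_apply, g_app]
  set M := MulAction.period g p with hM
  have hdvd : ∀ j : ℤ, (g ^ j) p = p ↔ (M : ℤ) ∣ j := fun j =>
    MulAction.zpow_smul_eq_iff_period_dvd (g := g) (a := p)
  have heq : ∀ i j : ℤ, (g ^ i) p = (g ^ j) p ↔ (M : ℤ) ∣ i - j := by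
    intro i j
    rw [← hdvd, sub_eq_neg_add, zpow_add, Equiv.Perm.mul_apply, zpow_neg, Equiv.Perm.inv_eq_iff_eq]
  have hM0 : 0 < M := by
    obtain ⟨L, hL, h⟩ := hper
    have h' : b ((g ^ (L : ℤ)) p) = (g ^ (L : ℤ)) p := by
      rw [zpow_natCast, ← Equiv.Perm.iterate_eq_pow]; exact h
    rw [hbgp, heq] at h'
    have := h'
    rcases Nat.eq_zero_or_pos M with h0 | h0
    · rw [h0, Nat.cast_zero, zero_dvd_iff] at this; omega
    · exact h0
  have hM1 : M ≠ 1 := by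
    intro h1
    have := (hdvd 1).2 (by simp [h1])
    rw [zpow_one, g_app] at this
    apply hap
    rw [← hb (a p), this, hbp]
  refine ⟨(g ^ ((M / 2 : ℕ) : ℤ)) p, ⟨⟨?_, hreach _⟩, ?_⟩, ?_⟩
  · rw [Ne, hdvd]
    intro h
    have := Int.le_of_dvd (by omega) h
    omega
  · rw [hagp, hbgp, heq, heq]
    rcases Nat.even_or_odd' M with ⟨c, hc | hc⟩
    · right; exact ⟨-1, by omega⟩
    · left; exact ⟨-1, by omega⟩
  · rintro q ⟨⟨hqp, hq⟩, hfix⟩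
    obtain ⟨j, rfl⟩ := (hcomp _ _ hq).1 ⟨0, by simp⟩
    rw [Ne, hdvd] at hqp
    rw [hagp, hbgp, heq, heq] at hfix
    rw [heq]
    have hr0 : 0 < j % M := by
      have := Int.emod_nonneg j (b := M) (by omega)
      rcases this.lt_or_eq with h | h
      · exact h
      · exact absurd (Int.dvd_of_emod_eq_zero h.symm) hqp
    have hr1 : j % M < M := Int.emod_lt_of_pos _ (by omega)
    have hj := Int.emod_add_mul_ediv j M
    generalize j % M = r at *
    generalize j / M = u at *
    have key : r = ((M / 2 : ℕ) : ℤ) := by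
      rcases hfix with ⟨c, hc⟩ | ⟨c, hc⟩
      · have h1 : (2 * r + 1) = M * (-c - 2 * u) := by linarith
        have h2 : (0:ℤ) < -c - 2 * u := by
          by_contra h; nlinarith
        have h3 : (-c - 2 * u) < 2 := by
          by_contra h; nlinarith
        have h4 : -c - 2 * u = 1 := by omega
        rw [h4] at h1; omega
      · have h1 : (2 * r) = M * (-c - 2 * u) := by linarith
        have h2 : (0:ℤ) < -c - 2 * u := by
          by_contra h; nlinarith
        have h3 : (-c - 2 * u) < 2 := by
          by_contra h; nlinarith
        have h4 : -c - 2 * u = 1 := by omega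
        rw [h4] at h1; omega
    exact ⟨u, by rw [← key]; linarith⟩

theorem upperStep_upperStep (α : Diagram m n) (x : Glued k m n) :
    upperStep α (upperStep α x) = x := by
  have key : ∀ e : Ends m n, upperStep α (upperEnds (k := k) e) = upperEnds (α.arc e) := by
    rintro (p | p) <;> rfl
  rcases x with p | p | p
  · exact (key _).trans (by rw [α.arc_arc]; rfl)
  · exact (key _).trans (by rw [α.arc_arc]; rfl)
  · rfl

theorem lowerStep_lowerStep (β : Diagram k m) (x : Glued k m n) :
    lowerStep β (lowerStep β x) = x := by
  rcases x with p | p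
  · rfl
  · simp [lowerStep, β.arc_arc]

theorem upperStep_sh (α : Diagram m n) (t : ℤ) (x : Glued k m n) :
    upperStep α (shG t x) = shG t (upperStep α x) := by
  have key : ∀ e : Ends m n, upperEnds (k := k) (shE t e) = shG t (upperEnds e) := by
    rintro (p | p) <;> rfl
  rcases x with p | p | p
  · exact (congrArg upperEnds (α.arc_sh t (.inl p))).trans (key _)
  · exact (congrArg upperEnds (α.arc_sh t (.inr p))).trans (key _)
  · rfl

theorem lowerStep_sh (β : Diagram k m) (t : ℤ) (x : Glued k m n) :
    lowerStep β (shG t x) = shG t (lowerStep β x) := by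
  rcases x with p | p
  · rfl
  · exact congrArg Sum.inr (β.arc_sh t p)

theorem outer_injective : Function.Injective (outer : Ends k n → Glued k m n) := by
  rintro (p | p) (q | q) h <;> simp_all [outer]

theorem step_fixed_iff (α : Diagram m n) (β : Diagram k m) (x : Glued k m n) :
    (upperStep α x = x ∨ lowerStep β x = x) ↔ ∃ p, outer p = x := by
  have hinj : Function.Injective (upperEnds : Ends m n → Glued k m n) := by
    rintro (p | p) (q | q) h <;> simp_all [upperEnds]
  have h1 : ∀ p : Pt m, upperStep α (seam p : Glued k m n) ≠ seam p := fun p h =>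
    α.arc_ne (.inr p) (hinj h)
  have h2 : ∀ p : Pt m, lowerStep β (seam p : Glued k m n) ≠ seam p := fun p h =>
    β.arc_ne (.inl p) (Sum.inr_injective h)
  rcases x with p | p | p
  · exact iff_of_true (Or.inr rfl) ⟨.inl p, rfl⟩
  · refine iff_of_false (not_or.2 ⟨h1 p, h2 p⟩) ?_
    rintro ⟨q | q, h⟩ <;> simp [outer] at h
  · exact iff_of_true (Or.inl rfl) ⟨.inr p, rfl⟩

theorem exists_return (a b : Glued k m n → Glued k m n) (ha : ∀ x, a (a x) = x)
    (hb : ∀ x, b (b x) = x) (hsa : ∀ t x, a (shG t x) = shG t (a x))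
    (hsb : ∀ t x, b (shG t x) = shG t (b x)) (p : Glued k m n) (hp : b p = p) :
    ∃ L : ℕ, 0 < L ∧ b ((fun x => b (a x))^[L] p) = (fun x => b (a x))^[L] p := by
  let G : Glued k m n → Glued k m n := fun x => b (a x)
  have hinj : Function.Injective G := fun x y h => by
    have := congrArg (fun z => a (b z)) h
    simpa [G, ha, hb] using this
  have hG : ∀ t, Function.Commute G (shG t) := fun t x => by simp [G, hsa, hsb]
  let pr : Glued k m n → Fin n ⊕ (Fin m ⊕ Fin k) :=
    Sum.map Prod.fst (Sum.map Prod.fst Prod.fst)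
  have hpr : ∀ x y, pr x = pr y → ∃ t, y = shG t x := by
    rintro (x | x | x) (y | y | y) h <;> simp only [pr, Sum.map_inl, Sum.map_inr, Sum.inl.injEq,
      Sum.inr.injEq, reduceCtorEq] at h <;>
    exact ⟨y.2 - x.2, by simp [shG, sh, h]⟩
  obtain ⟨i, j, hij, h⟩ := Finite.exists_ne_map_eq_of_infinite fun i : ℕ => pr (G^[i] p)
  wlog hlt : i < j generalizing i j
  · exact this j i hij.symm h.symm (by omega)
  obtain ⟨t, ht⟩ := hpr _ _ h
  have h3 : G^[j - i] p = shG t p := by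
    apply hinj.iterate i
    rw [← Function.iterate_add_apply, Nat.add_sub_cancel' hlt.le, ht,
      ((hG t).iterate_left i).eq]
  refine ⟨j - i, by omega, ?_⟩
  change b (G^[j - i] p) = G^[j - i] p
  rw [h3, hsb, hp]

theorem existsUnique_partner (α : Diagram m n) (β : Diagram k m) (p : Ends k n) :
    ∃! q : Ends k n, q ≠ p ∧ Conn α β (outer p) (outer q) := by
  have main : ∃! x : Glued k m n, (x ≠ outer p ∧ Conn α β (outer p) x) ∧
      (upperStep α x = x ∨ lowerStep β x = x) := by
    rcases p with p | p
    · exact two_involutions (upperStep α) (lowerStep β) (upperStep_upperStep α)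
        (lowerStep_lowerStep β) _ rfl
        (by
          intro h
          rcases h4 : α.arc (.inl p) with q | q
          · simp only [outer, Sum.map_inl, id, upperStep, h4, upperEnds, Sum.inl.injEq] at h
            exact α.arc_ne _ (h4.trans (congrArg _ h))
          · simp [outer, upperStep, h4, upperEnds] at h)
        (exists_return _ _ (upperStep_upperStep α) (lowerStep_lowerStep β) (upperStep_sh α)
          (lowerStep_sh β) _ rfl)
    · have := two_involutions (lowerStep β) (upperStep α) (lowerStep_lowerStep β)
        (upperStep_upperStep α) (outer (.inr p) : Glued k m n) rfl
        (by
          intro h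
          exact β.arc_ne _ (Sum.inr_injective h))
        (exists_return _ _ (lowerStep_lowerStep β) (upperStep_upperStep α) (lowerStep_sh β)
          (upperStep_sh α) _ rfl)
      simpa only [Conn, or_comm] using this
  obtain ⟨x, ⟨⟨hx1, hx2⟩, hx3⟩, hu⟩ := main
  obtain ⟨q, rfl⟩ := (step_fixed_iff α β x).1 hx3
  refine ⟨q, ⟨fun h => hx1 (by rw [h]), hx2⟩, ?_⟩
  rintro r ⟨hr1, hr2⟩
  exact outer_injective (hu (outer r) ⟨⟨fun h => hr1 (outer_injective h), hr2⟩,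
    (step_fixed_iff α β _).2 ⟨r, rfl⟩⟩)

theorem Conn.sh {α : Diagram m n} {β : Diagram k m} {x y : Glued k m n} (h : Conn α β x y)
    (t : ℤ) : Conn α β (shG t x) (shG t y) := by
  induction h with
  | rel x y h =>
    refine .rel _ _ ?_
    rcases h with rfl | rfl
    · exact Or.inl (upperStep_sh α t x).symm
    · exact Or.inr (lowerStep_sh β t x).symm
  | refl x => exact .refl _
  | symm x y _ ih => exact ih.symm
  | trans x y z _ _ ih1 ih2 => exact ih1.trans _ _ _ ih2

/-- The other end of the curve of the glued strip that starts at `p`. -/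
noncomputable def partner (α : Diagram m n) (β : Diagram k m) (p : Ends k n) : Ends k n :=
  (existsUnique_partner α β p).choose

theorem partner_spec (α : Diagram m n) (β : Diagram k m) (p : Ends k n) :
    partner α β p ≠ p ∧ Conn α β (outer p) (outer (partner α β p)) :=
  (existsUnique_partner α β p).choose_spec.1

theorem eq_partner {α : Diagram m n} {β : Diagram k m} {p q : Ends k n} (h : q ≠ p)
    (hc : Conn α β (outer p) (outer q)) : partner α β p = q :=
  (existsUnique_partner α β p).unique (partner_spec α β p) ⟨h, hc⟩

/-- The curve through the `i`-th point of the common circle is closed (on the cylinder). -/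
def IsClosedCurve (α : Diagram m n) (β : Diagram k m) (i : Fin m) : Prop :=
  ∀ p : Ends k n, ¬ Conn α β (seam (i, 0)) (outer p)

/-- The curve (on the cylinder) through the `i`-th point of the common circle, given by the set of
points of the common circle on it. -/
def curve (α : Diagram m n) (β : Diagram k m) (i : Fin m) : Set (Fin m) :=
  {j | ∃ t, Conn α β (seam (i, 0)) (seam (j, t))}

/-- The number of loops of the glued diagram: closed curves that are contractible on the cylinder,
i.e. whose lifts to the strip are closed. -/
noncomputable def loops (α : Diagram m n) (β : Diagram k m) : ℕ :=
  Set.ncard {c | ∃ i, c = curve α β i ∧ IsClosedCurve α β i ∧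
    ∀ t, Conn α β (seam (i, 0)) (seam (i, t)) → t = 0}

/-- The number of new circles around the cylinder that appear after gluing: closed curves whose
lifts to the strip are not closed. -/
noncomputable def newCircles (α : Diagram m n) (β : Diagram k m) : ℕ :=
  Set.ncard {c | ∃ i, c = curve α β i ∧ IsClosedCurve α β i ∧
    ∃ t, t ≠ 0 ∧ Conn α β (seam (i, 0)) (seam (i, t))}

/-- The composition `α ∘ β`: glue the bottom of `α` to the top of `β` and remove the loops. -/
noncomputable def comp (α : Diagram m n) (β : Diagram k m) : Diagram k n where
  arc := partner α β
  arc_arc p := eq_partner (partner_spec α β p).1.symm (partner_spec α β p).2.symm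
  arc_ne p := (partner_spec α β p).1
  arc_sh t p := by
    have hinj : Function.Injective (shE t : Ends k n → Ends k n) := by
      rintro (⟨p, u⟩ | ⟨p, u⟩) (⟨q, v⟩ | ⟨q, v⟩) h <;> simp_all [shE, AffineTL.sh]
    have hout : ∀ q : Ends k n, (outer (shE t q) : Glued k m n) = shG t (outer q) := by
      rintro (q | q) <;> rfl
    refine eq_partner (fun h => (partner_spec α β p).1 (hinj h)) ?_
    rw [hout, hout]
    exact (partner_spec α β p).2.sh t
  circles := α.circles + β.circles + newCircles α β

end Gluing

/-- The product `α β = δ ^ m(α, β) • (α ∘ β)`, extended bilinearly to linear combinations of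
diagrams. -/
noncomputable def product (δ : ℂ) (k m n : ℕ) :
    (Diagram m n →₀ ℂ) →ₗ[ℂ] (Diagram k m →₀ ℂ) →ₗ[ℂ] (Diagram k n →₀ ℂ) :=
  Finsupp.linearCombination ℂ fun α => Finsupp.linearCombination ℂ fun β =>
    δ ^ loops α β • Finsupp.single (comp α β) (1 : ℂ)

/-- The space of the algebra `T_N(δ)`: the linear combinations of affine diagrams from `N` to `N`.
The multiplication of `T_N(δ)` is `product δ N N N`. -/
noncomputable def TL (N : ℕ) : Submodule ℂ (Diagram N N →₀ ℂ) :=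
  Submodule.span ℂ {a | ∃ α : Diagram N N, IsAffine α ∧ a = Finsupp.single α 1}

/-! ### Twists and standard diagrams -/

/-- The lifted marked point whose position is `r` more than that of `p`. -/
def translate {k : ℕ} (r : ℤ) (p : Pt k) : Pt k :=
  (⟨((pos p + r) % k).toNat, by
    have h := p.1.pos
    have h1 := Int.emod_lt_of_pos (pos p + r) (b := k) (by omega)
    have h2 := Int.emod_nonneg (pos p + r) (b := k) (by omega)
    omega⟩, (pos p + r) / k)

theorem pos_translate {k : ℕ} (r : ℤ) (p : Pt k) : pos (translate r p) = pos p + r := by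
  have h := p.1.pos
  have h2 := Int.emod_nonneg (pos p + r) (b := k) (by omega)
  have h3 := Int.emod_add_mul_ediv (pos p + r) k
  rw [translate, pos]
  simp only [Int.toNat_of_nonneg h2]
  linarith

theorem pos_injective {k : ℕ} : Function.Injective (pos : Pt k → ℤ) := by
  rintro ⟨i, t⟩ ⟨j, u⟩ h
  have hi := i.isLt
  have hj := j.isLt
  simp only [pos] at h
  have htu : t = u := by
    have h1 : (t - u) * (k : ℤ) = j - i := by linarith
    by_contra hne
    rcases lt_or_gt_of_ne hne with h2 | h2
    · have : (t - u) * (k : ℤ) ≤ -1 * k := by gcongr; omega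
      omega
    · have : 1 * (k : ℤ) ≤ (t - u) * k := by gcongr; omega
      omega
  subst htu
  have : i = j := Fin.ext (by omega)
  rw [this]

theorem pos_sh {k : ℕ} (t : ℤ) (p : Pt k) : pos (sh t p) = pos p + t * k := by
  simp only [pos, sh]; ring

/-- The power `τ_k ^ r` of the twist.  If `k > 0` then `τ_k` joins the `i`-th bottom point to
the `(i + 1)`-st top point (and the last bottom point, across the cut, to the first top point), and
`r` may be any integer.  If `k = 0` then `τ_0` is one circle around the cylinder and `r ≥ 0`. -/
def twist (k : ℕ) (r : ℤ) : Diagram k k where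
  arc
    | .inl p => .inr (translate (-r) p)
    | .inr p => .inl (translate r p)
  arc_arc := by
    rintro (p | p) <;> simp only [Sum.inl.injEq, Sum.inr.injEq] <;> apply pos_injective <;>
      simp [pos_translate]
  arc_ne := by rintro (p | p) <;> simp
  arc_sh := by
    rintro t (p | p) <;> simp only [shE, Sum.map_inl, Sum.map_inr, Sum.inl.injEq,
      Sum.inr.injEq] <;> apply pos_injective <;> simp only [pos_translate, pos_sh] <;> ring
  circles := if k = 0 then r.toNat else 0

/-- No arc joins a bottom point to a bottom point. -/
def IsMonic {m n : ℕ} (α : Diagram m n) : Prop := ∀ p q, α.arc (.inr p) ≠ .inr q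

/-- A standard diagram: a monic affine diagram without circles, none of whose arcs from the top to
the bottom crosses the cut. -/
def IsStandard {k N : ℕ} (α : Diagram k N) : Prop :=
  IsAffine α ∧ IsMonic α ∧ α.circles = 0 ∧ ∀ p q, α.arc (.inl p) = .inr q → p.2 = q.2

/-- The set of standard diagrams from `k` to `N`; its cardinality is `d_k`. -/
abbrev Std (k N : ℕ) : Type := {α : Diagram k N // IsStandard α}

instance finite_std (k N : ℕ) : Finite (Std k N) := by
  let e : Fin N ⊕ Fin k → Ends k N := Sum.map (fun i => (i, 0)) (fun i => (i, 0))
  let enc : Ends k N → (Fin N ⊕ Fin k) × ℤ :=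
    Sum.elim (fun p => (.inl p.1, p.2)) (fun p => (.inr p.1, p.2))
  have henc : Function.Injective enc := by
    rintro (⟨p, u⟩ | ⟨p, u⟩) (⟨q, v⟩ | ⟨q, v⟩) h <;> simp_all [enc]
  have hbound : ∀ (α : Std k N) x, (enc (α.1.arc (e x))).2 ∈ Set.Icc (-1 : ℤ) 1 := by
    rintro ⟨α, ⟨hpl, -⟩, hmon, -, hthr⟩ (i | i)
    · change (enc (α.arc (.inl (i, 0)))).2 ∈ _
      rcases h : α.arc (.inl (i, 0)) with ⟨j, t⟩ | ⟨j, t⟩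
      · have hi := i.isLt
        have hj := j.isLt
        have h' : α.arc (.inl (j, t)) = .inl (i, 0) := by rw [← h, α.arc_arc]
        have hs := α.arc_sh 1 (.inl (i, 0))
        have hs' := α.arc_sh 1 (.inl (j, t))
        rw [h] at hs
        rw [h'] at hs'
        have hN : (0 : ℤ) < N := by omega
        constructor
        · change -1 ≤ t
          by_contra hlt
          refine hpl ⟨.inl (j, t), shE 1 (.inl (j, t)), ?_, ?_, ?_⟩
          · simp only [shE, Sum.map_inl, Before, pos_sh]; omega
          · rw [h']
            simp only [shE, Sum.map_inl, Before, sh, pos]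
            nlinarith
          · rw [h', hs']
            simp only [shE, Sum.map_inl, Before, pos_sh]; omega
        · change t ≤ 1
          by_contra hlt
          refine hpl ⟨.inl (i, 0), shE 1 (.inl (i, 0)), ?_, ?_, ?_⟩
          · simp only [shE, Sum.map_inl, Before, pos_sh]; omega
          · rw [h]
            simp only [shE, Sum.map_inl, Before, sh, pos]
            nlinarith
          · rw [h, hs]
            simp only [shE, Sum.map_inl, Before, pos_sh]; omega
      · have := hthr _ _ h
        simp only at this
        simp [enc, ← this]
    · change (enc (α.arc (.inr (i, 0)))).2 ∈ _
      rcases h : α.arc (.inr (i, 0)) with ⟨j, t⟩ | ⟨j, t⟩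
      · have := hthr (j, t) (i, 0) (by rw [← h, α.arc_arc])
        simp only at this
        simp [enc, this]
      · exact absurd h (hmon _ _)
  let f : Std k N → (Fin N ⊕ Fin k) → (Fin N ⊕ Fin k) × Set.Icc (-1 : ℤ) 1 :=
    fun α x => ((enc (α.1.arc (e x))).1, ⟨_, hbound α x⟩)
  refine Finite.of_injective f ?_
  intro α β h
  have h1 : ∀ x, α.1.arc (e x) = β.1.arc (e x) := fun x => by
    have h2 := congrFun h x
    simp only [f, Prod.mk.injEq, Subtype.mk.injEq] at h2
    exact henc (Prod.ext h2.1 h2.2)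
  apply Subtype.ext
  apply Diagram.ext
  · funext p
    have hp : ∃ t x, p = shE t (e x) := by
      rcases p with ⟨i, t⟩ | ⟨i, t⟩
      · exact ⟨t, .inl i, by simp [shE, e, sh]⟩
      · exact ⟨t, .inr i, by simp [shE, e, sh]⟩
    obtain ⟨t, x, rfl⟩ := hp
    rw [α.1.arc_sh, β.1.arc_sh, h1]
  · rw [α.2.2.2.1, β.2.2.2.1]

noncomputable instance fintypeStd (k N : ℕ) : Fintype (Std k N) := Fintype.ofFinite _

noncomputable instance decidableEqStd (k N : ℕ) : DecidableEq (Std k N) := Classical.decEq _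

/-! ### The bimodules `M_k` and the matrices of the action -/

open Classical in
/-- The coordinate, along the basis element `γ` of the free right `ℂ[x, 1/x]`-module `M_k`, of the
class of the diagram `χ` from `k` to `N`.

For `k > 0` the module `M_k` is spanned by the monic diagrams (the other diagrams are zero), and
`x` acts as `τ_k` on the right: the class of `γ ∘ τ_k ^ r` is `γ x ^ r`.  For `k = 0` the module
has the standard diagrams as basis, and the class of `γ ∘ τ_0 ^ r` is `γ (x + 1/x) ^ r`. -/
noncomputable def coordDiagram {k N : ℕ} (χ : Diagram k N) (γ : Std k N) : ℂ[T;T⁻¹] :=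
  if k = 0 then
    if h : ∃ r : ℕ, χ = comp γ.1 (twist k r) then
      (LaurentPolynomial.T 1 + LaurentPolynomial.T (-1)) ^ h.choose
    else 0
  else
    if h : ∃ r : ℤ, χ = comp γ.1 (twist k r) then LaurentPolynomial.T h.choose else 0

/-- The coordinates in `M_k` of a linear combination of diagrams from `k` to `N`. -/
noncomputable def coord (k N : ℕ) : (Diagram k N →₀ ℂ) →ₗ[ℂ] (Std k N → ℂ[T;T⁻¹]) :=
  Finsupp.linearCombination ℂ coordDiagram

/-- The index set `𝒯_N = {t : 0 ≤ t ≤ N, t ≡ N mod 2}`. -/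
abbrev Index (N : ℕ) : Type := {t : ℕ // t ≤ N ∧ t ≡ N [MOD 2]}

/-- The ring `∏ k ∈ 𝒯_N, Mat_{d_k}(ℂ[x, 1/x])`. -/
abbrev MatProd (N : ℕ) : Type := ∀ k : Index N, Matrix (Std k N) (Std k N) ℂ[T;T⁻¹]

/-- The matrices of the left action of `a` on the modules `M_k` in the bases of standard
diagrams: the column `β` of the component `k` holds the coordinates of `a β`. -/
noncomputable def rep (δ : ℂ) (N : ℕ) (a : Diagram N N →₀ ℂ) : MatProd N := fun k =>
  Matrix.of fun γ β => coord k N (product δ k N N a (Finsupp.single β.1 1)) γ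

/-- The image of `T_N(δ)` in `∏ k ∈ 𝒯_N, Mat_{d_k}(ℂ[x, 1/x])`. -/
def image (δ : ℂ) (N : ℕ) : Set (MatProd N) := rep δ N '' TL N

/-- The diagonal embedding of `∏ k ∈ 𝒯_N, ℂ[x, 1/x]`: the family `f` goes to the matrices that
are scalar with value `f k` in the component `k`. -/
noncomputable def scalarEmbedding (N : ℕ) : (Index N → ℂ[T;T⁻¹]) →+* MatProd N :=
  RingHom.pi fun k => (Matrix.scalar (Std k N)).comp (Pi.evalRingHom _ k)

end AffineTL

namespace AffineTL

/-! ### Monic diagrams and their through lines -/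

/-! Scalar families commute with everything because the coefficient ring is commutative, so the
content is that the image is large enough to force scalars. Fix `k` and standard diagrams γ, γ' from
`k` to `N`. Turning γ' upside down and putting γ on top gives an affine diagram γ ∘ flip γ' from `N`
to `N`. Applied to a standard ρ it yields γ ∘ (flip γ' ∘ ρ), and the inner factor is a diagram from
`k` to `k`: it contributes a coefficient ⟨γ', ρ⟩ in ℂ[x, 1/x] and leaves a multiple of γ. Hence in
component `k` this diagram acts by a matrix whose only possibly nonzero row is row γ, with entries
⟨γ', ρ⟩ that do not depend on γ (`rep_single_push`). If γ' and β satisfy ⟨γ', β⟩ ≠ 0, then commuting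
with these matrices for all γ makes a matrix scalar (`eq_scalar_of_commute_row`); only cancellation
in a domain is needed, not invertibility of the pairing. Such a pair is explicit
(`exists_pairing_ne_zero`): two families of cups shifted against each other by one point, whose
union is a zigzag without contractible loops. No power of δ appears, so δ = 0 needs no separate
treatment. Left composition with a monic γ never meets the closed-curve bookkeeping of `comp`: γ
only carries its through lines along and adds its cups. This is the explicit diagram `push`, with
`comp_push` as the associativity needed and `comp_twist` as the link to the identifications defining
M_k. -/

theorem pos_lt_pos_iff {n : ℕ} (p q : Pt n) :
    pos p < pos q ↔ p.2 < q.2 ∨ p.2 = q.2 ∧ p.1.val < q.1.val := by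
  have hp := p.1.isLt
  have hq := q.1.isLt
  simp only [pos]
  constructor
  · intro h
    rcases lt_trichotomy p.2 q.2 with h1 | h1 | h1
    · exact Or.inl h1
    · rw [h1] at h
      exact Or.inr ⟨h1, by omega⟩
    · have : (q.2 + 1) * (n : ℤ) ≤ p.2 * n := by gcongr; omega
      rw [add_mul] at this
      omega
  · rintro (h | ⟨h, h1⟩)
    · have : (p.2 + 1) * (n : ℤ) ≤ q.2 * n := by gcongr; omega
      rw [add_mul] at this
      omega
    · rw [h]; omega

section Through

variable {k m n N : ℕ} {γ : Diagram k N} (hγ : IsMonic γ)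

/-- The top end of the arc of a monic diagram that starts at a given bottom point. -/
noncomputable def through (p : Pt k) : Pt N :=
  (show ∃ q, γ.arc (.inr p) = .inl q by
    rcases h : γ.arc (.inr p) with q | q
    · exact ⟨q, rfl⟩
    · exact absurd h (hγ p q)).choose

theorem arc_inr_eq_through (p : Pt k) : γ.arc (.inr p) = .inl (through hγ p) :=
  (show ∃ q, γ.arc (.inr p) = .inl q by
    rcases h : γ.arc (.inr p) with q | q
    · exact ⟨q, rfl⟩
    · exact absurd h (hγ p q)).choose_spec

theorem arc_through (p : Pt k) : γ.arc (.inl (through hγ p)) = .inr p := by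
  rw [← arc_inr_eq_through hγ, γ.arc_arc]

theorem arc_inl_eq_inr_iff {p : Pt N} {j : Pt k} :
    γ.arc (.inl p) = .inr j ↔ through hγ j = p := by
  constructor
  · intro h
    have := arc_inr_eq_through hγ j
    rw [← h, γ.arc_arc] at this
    exact (Sum.inl_injective this).symm
  · rintro rfl
    exact arc_through hγ j

theorem through_injective : Function.Injective (through hγ) := fun p q h => by
  have := arc_through hγ p
  rw [h, arc_through hγ] at this
  exact (Sum.inr_injective this).symm

theorem through_sh (t : ℤ) (p : Pt k) : through hγ (sh t p) = sh t (through hγ p) := by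
  have h := γ.arc_sh t (.inr p)
  rw [arc_inr_eq_through hγ p] at h
  have h1 := arc_inr_eq_through hγ (sh t p)
  exact Sum.inl_injective (h1.symm.trans h)

/-- `Before` runs along the bottom line from right to left, so two through lines in reversed order
would be interlaced. -/
theorem pos_through_lt (ha : IsAffine γ) {p q : Pt k} (h : pos p < pos q) :
    pos (through hγ p) < pos (through hγ q) := by
  by_contra hlt
  have hne : through hγ p ≠ through hγ q := fun h1 => by
    rw [through_injective hγ h1] at h
    exact lt_irrefl _ h
  have h1 : pos (through hγ q) < pos (through hγ p) :=
    lt_of_le_of_ne (not_lt.1 hlt) fun h1 => hne (pos_injective h1.symm)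
  refine ha.1 ⟨.inl (through hγ q), .inl (through hγ p), h1, ?_, ?_⟩
  · rw [arc_through]; trivial
  · rw [arc_through, arc_through]; exact h

/-- The ends of a cylinder with `k` top points, with the top points moved along the through
lines of a monic diagram. -/
noncomputable def alongEnds : Ends m k → Ends m N := Sum.map (through hγ) id

theorem alongEnds_injective : Function.Injective (alongEnds hγ : Ends m k → Ends m N) :=
  Sum.map_injective.2 ⟨through_injective hγ, Function.injective_id⟩

theorem alongEnds_shE (t : ℤ) (p : Ends m k) :
    alongEnds hγ (shE t p) = shE t (alongEnds hγ p) := by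
  rcases p with p | p
  · exact congrArg Sum.inl (through_sh hγ t p)
  · rfl

theorem Before.asymm {p q : Ends m n} (h : Before p q) : ¬ Before q p := by
  rcases p with p | p <;> rcases q with q | q <;> simp only [Before, not_false_iff,
    not_lt] at h ⊢ <;> exact h.le

theorem Before.trichotomy {p q : Ends m n} (h : p ≠ q) : Before p q ∨ Before q p := by
  rcases p with p | p <;> rcases q with q | q <;> simp only [Before, true_or, or_true] <;>
    simp only [ne_eq, Sum.inl.injEq, Sum.inr.injEq] at h
  · exact lt_or_gt_of_ne fun h1 => h (pos_injective h1)
  · exact (lt_or_gt_of_ne fun h1 => h (pos_injective h1)).symm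

theorem before_alongEnds_iff (ha : IsAffine γ) {p q : Ends m k} :
    Before (alongEnds hγ p) (alongEnds hγ q) ↔ Before p q := by
  have key : ∀ {p q : Ends m k}, Before p q → Before (alongEnds hγ p) (alongEnds hγ q) := by
    rintro (p | p) (q | q) h
    · exact pos_through_lt hγ ha h
    · trivial
    · exact h
    · exact h
  refine ⟨fun h => ?_, key⟩
  by_cases hpq : p = q
  · rw [hpq] at h
    exact absurd h h.asymm
  · exact (Before.trichotomy hpq).resolve_right fun h1 => h.asymm (key h1)

/-! ### Composition with a monic diagram on the left -/

/-- The arcs of `γ ∘ κ` for a monic diagram `γ`. -/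
noncomputable def pushArc (κ : Diagram m k) : Ends m N → Ends m N
  | .inl p => Sum.elim Sum.inl (fun j => alongEnds hγ (κ.arc (.inl j))) (γ.arc (.inl p))
  | .inr p => alongEnds hγ (κ.arc (.inr p))

theorem pushArc_alongEnds (κ : Diagram m k) (p : Ends m k) :
    pushArc hγ κ (alongEnds hγ p) = alongEnds hγ (κ.arc p) := by
  rcases p with p | p
  · simp [alongEnds, pushArc, arc_through hγ]
  · rfl

theorem pushArc_of_cup (κ : Diagram m k) {p q : Pt N} (h : γ.arc (.inl p) = .inl q) :
    pushArc hγ κ (.inl p) = .inl q := by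
  simp [pushArc, h]

/-- The basic dichotomy for γ ∘ κ: an end either lies on a cup of γ or comes from an end of κ.
Statements about `push` are checked on these two kinds of ends. -/
theorem cup_or_alongEnds (p : Ends m N) :
    (∃ q r, p = .inl q ∧ γ.arc (.inl q) = .inl r) ∨ ∃ q, p = alongEnds hγ q := by
  rcases p with p | p
  · rcases h : γ.arc (.inl p) with q | q
    · exact Or.inl ⟨p, q, rfl, h⟩
    · exact Or.inr ⟨.inl q, congrArg Sum.inl ((arc_inl_eq_inr_iff hγ).1 h).symm⟩
  · exact Or.inr ⟨.inr p, rfl⟩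

/-- The diagram `γ ∘ κ` for a monic diagram `γ` without circles. -/
noncomputable def push (κ : Diagram m k) : Diagram m N where
  arc := pushArc hγ κ
  arc_arc p := by
    rcases cup_or_alongEnds hγ p with ⟨q, r, rfl, h⟩ | ⟨q, rfl⟩
    · rw [pushArc_of_cup hγ κ h]
      exact pushArc_of_cup hγ κ (by rw [← h, γ.arc_arc])
    · rw [pushArc_alongEnds, pushArc_alongEnds, κ.arc_arc]
  arc_ne p := by
    rcases cup_or_alongEnds hγ p with ⟨q, r, rfl, h⟩ | ⟨q, rfl⟩
    · rw [pushArc_of_cup hγ κ h]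
      intro h1
      rw [Sum.inl_injective h1] at h
      exact γ.arc_ne _ h
    · rw [pushArc_alongEnds]
      exact fun h => κ.arc_ne _ (alongEnds_injective hγ h)
  arc_sh t p := by
    rcases cup_or_alongEnds hγ p with ⟨q, r, rfl, h⟩ | ⟨q, rfl⟩
    · rw [pushArc_of_cup hγ κ h]
      refine pushArc_of_cup hγ κ (q := sh t r) ?_
      have := γ.arc_sh t (.inl q)
      rw [h] at this
      exact this
    · rw [pushArc_alongEnds, ← alongEnds_shE, pushArc_alongEnds, κ.arc_sh, alongEnds_shE]
  circles := κ.circles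

theorem push_arc_alongEnds (κ : Diagram m k) (p : Ends m k) :
    (push hγ κ).arc (alongEnds hγ p) = alongEnds hγ (κ.arc p) :=
  pushArc_alongEnds hγ κ p

theorem push_arc_of_cup (κ : Diagram m k) {p q : Pt N} (h : γ.arc (.inl p) = .inl q) :
    (push hγ κ).arc (.inl p) = .inl q :=
  pushArc_of_cup hγ κ h

theorem push_injective : Function.Injective (push hγ : Diagram m k → Diagram m N) := by
  intro κ κ' h
  refine Diagram.ext (funext fun p => alongEnds_injective hγ ?_)
    (show (push hγ κ).circles = (push hγ κ').circles by rw [h])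
  rw [← push_arc_alongEnds, h, push_arc_alongEnds]

theorem isAffine_push (ha : IsAffine γ) {κ : Diagram m k} (hκ : IsAffine κ)
    (h0 : κ.circles = 0) : IsAffine (push hγ κ) := by
  refine ⟨?_, fun h => absurd (h0 ▸ h : 0 < 0) (lt_irrefl 0)⟩
  rintro ⟨p, q, h1, h2, h3⟩
  rcases cup_or_alongEnds hγ p with ⟨p, p', rfl, hp⟩ | ⟨p, rfl⟩ <;>
    rcases cup_or_alongEnds hγ q with ⟨q, q', rfl, hq⟩ | ⟨q, rfl⟩
  · rw [push_arc_of_cup hγ κ hp] at h2 h3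
    rw [push_arc_of_cup hγ κ hq] at h3
    refine ha.1 ⟨.inl p, .inl q, h1, ?_, ?_⟩
    · rw [hp]; exact h2
    · rw [hp, hq]; exact h3
  · rw [push_arc_of_cup hγ κ hp] at h2
    rcases q with j | j
    · refine ha.1 ⟨.inl p, .inl (through hγ j), h1, ?_, ?_⟩
      · rw [hp]; exact h2
      · rw [hp, arc_through]; trivial
    · exact h2
  · rw [push_arc_alongEnds] at h2 h3
    rw [push_arc_of_cup hγ κ hq] at h3
    rcases hp : κ.arc p with j | j
    · rw [hp] at h2 h3
      refine ha.1 ⟨.inl q, .inl (through hγ j), h2, ?_, ?_⟩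
      · rw [hq]; exact h3
      · rw [hq, arc_through]; trivial
    · rw [hp] at h3
      exact h3
  · rw [push_arc_alongEnds] at h2 h3
    rw [push_arc_alongEnds] at h3
    rw [before_alongEnds_iff hγ ha] at h1 h2 h3
    exact hκ.1 ⟨p, q, h1, h2, h3⟩

/-! ### Associativity of gluing for a monic left factor -/

/-- The points of a glued cylinder with `k` top points, with the top points moved along the through
lines of a monic diagram. -/
noncomputable def alongGlued {l : ℕ} : Glued l m k → Glued l m N :=
  Sum.map (through hγ) id

variable {l : ℕ} (κ : Diagram m k) (ρ : Diagram l m)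

theorem alongGlued_injective :
    Function.Injective (alongGlued hγ : Glued l m k → Glued l m N) :=
  Sum.map_injective.2 ⟨through_injective hγ, Function.injective_id⟩

theorem upperStep_alongGlued (x : Glued l m k) :
    upperStep (push hγ κ) (alongGlued hγ x) = alongGlued hγ (upperStep κ x) := by
  have key : ∀ e : Ends m k, (upperEnds (alongEnds hγ e) : Glued l m N) =
      alongGlued hγ (upperEnds e) := by
    rintro (p | p) <;> rfl
  rcases x with p | p | p
  · exact (congrArg upperEnds (push_arc_alongEnds hγ κ (.inl p))).trans (key _)
  · exact (congrArg upperEnds (push_arc_alongEnds hγ κ (.inr p))).trans (key _)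
  · rfl

theorem lowerStep_alongGlued (x : Glued l m k) :
    lowerStep ρ (alongGlued hγ x) = alongGlued hγ (lowerStep ρ x) := by
  rcases x with p | p <;> rfl

theorem Conn.alongGlued {x y : Glued l m k} (h : Conn κ ρ x y) :
    Conn (push hγ κ) ρ (AffineTL.alongGlued hγ x) (AffineTL.alongGlued hγ y) := by
  induction h with
  | rel x y h =>
    refine .rel _ _ ?_
    rcases h with rfl | rfl
    · exact Or.inl (upperStep_alongGlued hγ κ x).symm
    · exact Or.inr (lowerStep_alongGlued hγ ρ x).symm
  | refl x => exact .refl _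
  | symm x y _ ih => exact ih.symm
  | trans x y z _ _ ih1 ih2 => exact ih1.trans _ _ _ ih2

/-- The image of `alongGlued` is stable under both steps, hence a union of connected components. The
claim is made in both directions so that the induction passes through the symmetry case. -/
theorem Conn.exists_of_alongGlued {u v : Glued l m N} (h : Conn (push hγ κ) ρ u v) :
    (∀ x, u = AffineTL.alongGlued hγ x → ∃ y, v = AffineTL.alongGlued hγ y ∧ Conn κ ρ x y) ∧
    (∀ y, v = AffineTL.alongGlued hγ y → ∃ x, u = AffineTL.alongGlued hγ x ∧ Conn κ ρ y x) := by
  induction h with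
  | rel u v h =>
    rcases h with rfl | rfl
    · constructor
      · rintro x rfl
        exact ⟨_, upperStep_alongGlued hγ κ x, .rel _ _ (Or.inl rfl)⟩
      · intro y h
        refine ⟨upperStep κ y, ?_, .rel _ _ (Or.inl rfl)⟩
        rw [← upperStep_alongGlued, ← h, upperStep_upperStep]
    · constructor
      · rintro x rfl
        exact ⟨_, lowerStep_alongGlued hγ ρ x, .rel _ _ (Or.inr rfl)⟩
      · intro y h
        refine ⟨lowerStep ρ y, ?_, .rel _ _ (Or.inr rfl)⟩
        rw [← lowerStep_alongGlued, ← h, lowerStep_lowerStep]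
  | refl u => exact ⟨fun x h => ⟨x, h, .refl _⟩, fun x h => ⟨x, h, .refl _⟩⟩
  | symm u v _ ih => exact ⟨ih.2, ih.1⟩
  | trans u v w _ _ ih1 ih2 =>
    constructor
    · intro x hx
      obtain ⟨y, hy, hxy⟩ := ih1.1 x hx
      obtain ⟨z, hz, hyz⟩ := ih2.1 y hy
      exact ⟨z, hz, hxy.trans _ _ _ hyz⟩
    · intro z hz
      obtain ⟨y, hy, hzy⟩ := ih2.2 z hz
      obtain ⟨x, hx, hyx⟩ := ih1.2 y hy
      exact ⟨x, hx, hzy.trans _ _ _ hyx⟩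

theorem conn_alongGlued_iff {x y : Glued l m k} :
    Conn (push hγ κ) ρ (alongGlued hγ x) (alongGlued hγ y) ↔ Conn κ ρ x y := by
  refine ⟨fun h => ?_, Conn.alongGlued hγ κ ρ⟩
  obtain ⟨z, hz, hxz⟩ := (Conn.exists_of_alongGlued hγ κ ρ h).1 x rfl
  rwa [alongGlued_injective hγ hz]

theorem conn_seam_push_iff {p q : Pt m} :
    Conn (push hγ κ) ρ (seam p) (seam q) ↔ Conn κ ρ (seam p) (seam q) :=
  conn_alongGlued_iff hγ κ ρ (x := seam p) (y := seam q)

theorem curve_push (i : Fin m) : curve (push hγ κ) ρ i = curve κ ρ i := by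
  simp only [curve, conn_seam_push_iff]

theorem outer_alongEnds (p : Ends l k) :
    (outer (alongEnds hγ p) : Glued l m N) = alongGlued hγ (outer p) := by
  rcases p with p | p <;> rfl

theorem isClosedCurve_push_iff (i : Fin m) :
    IsClosedCurve (push hγ κ) ρ i ↔ IsClosedCurve κ ρ i := by
  constructor
  · intro h p hp
    refine h (alongEnds hγ p) ?_
    rw [outer_alongEnds]
    exact (conn_alongGlued_iff hγ κ ρ (x := seam (i, 0))).2 hp
  · intro h p hp
    obtain ⟨z, hz, hz1⟩ := (Conn.exists_of_alongGlued hγ κ ρ hp).1 (seam (i, 0)) rfl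
    rcases z with z | z | z
    · exact h (.inl z) hz1
    · rcases p with p | p <;> simp [outer, alongGlued] at hz
    · exact h (.inr z) hz1

theorem loops_push : loops (push hγ κ) ρ = loops κ ρ := by
  simp only [loops, curve_push, isClosedCurve_push_iff, conn_seam_push_iff]

theorem newCircles_push : newCircles (push hγ κ) ρ = newCircles κ ρ := by
  simp only [newCircles, curve_push, isClosedCurve_push_iff, conn_seam_push_iff]

/-- The cups of γ stay away from the common circle of κ and ρ, so each is already a complete curve;
all other curves, and all closed ones, are those of κ and ρ moved along the through lines. -/
theorem comp_push : comp (push hγ κ) ρ = push hγ (comp κ ρ) := by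
  refine Diagram.ext (funext fun p => ?_) ?_
  · rcases cup_or_alongEnds hγ p with ⟨q, r, rfl, h⟩ | ⟨q, rfl⟩
    · rw [push_arc_of_cup hγ _ h]
      refine eq_partner ?_ (.rel _ _ (Or.inl ?_))
      · intro h1
        rw [Sum.inl_injective h1] at h
        exact γ.arc_ne _ h
      · exact (congrArg upperEnds (push_arc_of_cup hγ κ h)).symm
    · rw [push_arc_alongEnds]
      refine eq_partner (fun h => (partner_spec κ ρ q).1 (alongEnds_injective hγ h)) ?_
      rw [outer_alongEnds, outer_alongEnds]
      exact ((partner_spec κ ρ q).2).alongGlued hγ κ ρ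
  · change κ.circles + ρ.circles + newCircles (push hγ κ) ρ = _
    rw [newCircles_push]
    rfl

theorem comp_twist (h0 : γ.circles = 0) (r : ℤ) : comp γ (twist k r) = push hγ (twist k r) := by
  have hu : ∀ p : Pt k, upperStep γ (seam p : Glued k k N) = .inl (through hγ p) := fun p =>
    congrArg upperEnds (arc_inr_eq_through hγ p)
  have hl : ∀ p : Pt k, lowerStep (twist k r) (seam p : Glued k k N) =
      outer (.inr (translate (-r) p)) := fun p => rfl
  refine Diagram.ext (funext fun p => ?_) ?_
  · refine eq_partner ((push hγ (twist k r)).arc_ne p) ?_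
    rcases cup_or_alongEnds hγ p with ⟨q, s, rfl, h⟩ | ⟨q, rfl⟩
    · rw [push_arc_of_cup hγ _ h]
      exact .rel _ _ (Or.inl (congrArg upperEnds h).symm)
    · rw [push_arc_alongEnds]
      rcases q with q | q
      · refine ((Relation.EqvGen.rel (seam q) _ (Or.inl (hu q).symm)).symm _ _).trans _ _ _ ?_
        exact .rel _ _ (Or.inr (hl q).symm)
      · refine (Relation.EqvGen.rel _ (seam (translate r q)) (Or.inr rfl)).trans _ _ _ ?_
        exact .rel _ _ (Or.inl (hu _).symm)
  -- Each point of the common circle is joined by the twist directly to a bottom point, so no curve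
  -- through it is closed.
  · have hn : newCircles γ (twist k r) = 0 := by
      rw [newCircles, Set.ncard_eq_zero (Set.toFinite _), Set.eq_empty_iff_forall_notMem]
      rintro c ⟨i, -, hi, -⟩
      exact hi _ (.rel _ _ (Or.inr (hl (i, 0)).symm))
    change γ.circles + (twist k r).circles + newCircles γ (twist k r) = (twist k r).circles
    rw [h0, hn, zero_add, add_zero]

end Through

/-! ### Turning a diagram upside down -/

/-- The diagram turned upside down. -/
def flip {m n : ℕ} (α : Diagram m n) : Diagram n m where
  arc p := (α.arc p.swap).swap
  arc_arc p := by simp [α.arc_arc]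
  arc_ne p h := α.arc_ne p.swap (by rw [← Sum.swap_swap (α.arc p.swap), h])
  arc_sh t p := by
    have key : ∀ {a b : ℕ} (e : Ends a b), (shE t e).swap = shE t e.swap := by
      rintro a b (e | e) <;> rfl
    rw [key, α.arc_sh, key]
  circles := α.circles

theorem isAffine_flip {m n : ℕ} {α : Diagram m n} (h : IsAffine α) : IsAffine (flip α) := by
  have hb : ∀ {p q : Ends n m}, Before p q → Before q.swap p.swap := by
    rintro (p | p) (q | q) h <;> exact h
  constructor
  · rintro ⟨p, q, h1, h2, h3⟩
    have e : ∀ x, ((flip α).arc x).swap = α.arc x.swap := fun x => Sum.swap_swap _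
    refine h.1 ⟨((flip α).arc q).swap, ((flip α).arc p).swap, hb h3, ?_, ?_⟩
    · rw [e q, α.arc_arc]; exact hb h2
    · rw [e q, e p, α.arc_arc, α.arc_arc]; exact hb h1
  · intro h0 p q hpq
    refine h.2 h0 q p ?_
    have h1 : (α.arc (.inr p)).swap = .inr q := hpq
    have h2 : α.arc (.inr p) = .inl q := by
      rw [← Sum.swap_swap (α.arc (.inr p)), h1]; rfl
    rw [← h2, α.arc_arc]

/-! ### Standard diagrams are determined by their classes in `M_k` -/

theorem IsStandard.isMonic {k N : ℕ} {γ : Diagram k N} (hγ : IsStandard γ) : IsMonic γ :=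
  hγ.2.1

theorem IsStandard.circles_eq_zero {k N : ℕ} {γ : Diagram k N} (hγ : IsStandard γ) :
    γ.circles = 0 :=
  hγ.2.2.1

/-- A twist creates no cups, so every cup of γ is a cup of σ. Hence the top ends of the through
lines of σ are among those of γ; there are `k` of each per turn, so the sets agree. As through lines
neither cross each other nor cross the cut, their top ends determine them, and then the cups agree
too. -/
theorem IsStandard.eq_of_push_eq {k N : ℕ} {γ σ : Diagram k N} (hγ : IsStandard γ)
    (hσ : IsStandard σ) {κ : Diagram k k} {r : ℤ}
    (h : push hγ.isMonic κ = push hσ.isMonic (twist k r)) : γ = σ := by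
  have hcup : ∀ p q, γ.arc (.inl p) = .inl q → σ.arc (.inl p) = .inl q := by
    intro p q hpq
    have h1 := push_arc_of_cup hγ.isMonic κ hpq
    rw [h] at h1
    rcases h2 : σ.arc (.inl p) with s | s
    · rw [push_arc_of_cup hσ.isMonic _ h2] at h1
      exact h1
    · rw [arc_inl_eq_inr_iff hσ.isMonic] at h2
      subst h2
      have h3 := push_arc_alongEnds hσ.isMonic (twist k r) (.inl s)
      exact absurd (h1.symm.trans h3) (by simp [twist, alongEnds])
  have hlift : ∀ {α : Diagram k N} (hα : IsStandard α) (i : Fin k) (t : ℤ),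
      through hα.isMonic (i, t) = ((through hα.isMonic (i, 0)).1, t) := by
    intro α hα i t
    have h1 : through hα.isMonic (i, t) = sh t (through hα.isMonic (i, 0)) := by
      rw [← through_sh]; simp [sh]
    have h2 := hα.2.2.2 _ _ (arc_through hα.isMonic (i, 0))
    rw [h1]
    simp only at h2
    simp [sh, h2]
  have hmono : ∀ {α : Diagram k N} (hα : IsStandard α),
      StrictMono fun i : Fin k => (through hα.isMonic (i, 0)).1 := by
    intro α hα i j hij
    have h1 : pos ((i, 0) : Pt k) < pos ((j, 0) : Pt k) := by
      rw [pos_lt_pos_iff]; exact Or.inr ⟨rfl, hij⟩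
    have h2 := pos_through_lt hα.isMonic hα.1 h1
    rw [hlift hα i 0, hlift hα j 0, pos_lt_pos_iff] at h2
    simpa using h2
  have hsub : Set.range (fun i : Fin k => (through hσ.isMonic (i, 0)).1) ⊆
      Set.range fun i : Fin k => (through hγ.isMonic (i, 0)).1 := by
    rintro _ ⟨i, rfl⟩
    rcases h1 : γ.arc (.inl (through hσ.isMonic (i, 0))) with q | j
    · have h2 := hcup _ _ h1
      rw [arc_through] at h2
      exact absurd h2 (by simp)
    · rw [arc_inl_eq_inr_iff hγ.isMonic] at h1
      refine ⟨j.1, ?_⟩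
      simp only
      rw [← h1, show j = (j.1, j.2) from rfl, hlift hγ j.1 j.2]
  have hrange := Set.eq_of_subset_of_ncard_le hsub (by
    rw [Set.ncard_range_of_injective (hmono hγ).injective,
      Set.ncard_range_of_injective (hmono hσ).injective]) (Set.toFinite _)
  have hfun := ((hmono hσ).range_inj (hmono hγ)).1 hrange
  have hthr : ∀ p, through hγ.isMonic p = through hσ.isMonic p := by
    rintro ⟨i, t⟩
    rw [hlift hγ, hlift hσ, ← congrFun hfun i]
  refine Diagram.ext (funext fun p => ?_) (hγ.circles_eq_zero.trans hσ.circles_eq_zero.symm)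
  rcases p with p | p
  · rcases h1 : γ.arc (.inl p) with q | q
    · exact (hcup _ _ h1).symm
    · rw [arc_inl_eq_inr_iff hγ.isMonic, hthr] at h1
      exact ((arc_inl_eq_inr_iff hσ.isMonic).2 h1).symm
  · rw [arc_inr_eq_through hγ.isMonic, arc_inr_eq_through hσ.isMonic, hthr]

/-! ### Coordinates and matrices of the diagrams γ ∘ κ -/

open Classical in
/-- The factor by which a diagram `κ` from `k` to `k` acts on `M_k` from the right, as read off by
`coordDiagram`. -/
noncomputable def twistCoeff {k : ℕ} (κ : Diagram k k) : ℂ[T;T⁻¹] :=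
  if k = 0 then
    if h : ∃ r : ℕ, κ = twist k r then
      (LaurentPolynomial.T 1 + LaurentPolynomial.T (-1)) ^ h.choose
    else 0
  else
    if h : ∃ r : ℤ, κ = twist k r then LaurentPolynomial.T h.choose else 0

theorem coordDiagram_push {k N : ℕ} (γ σ : Std k N) (κ : Diagram k k) :
    coordDiagram (push γ.2.isMonic κ) σ = if σ = γ then twistCoeff κ else 0 := by
  by_cases hσ : σ = γ
  · subst hσ
    rw [if_pos rfl]
    classical
    -- Both sides pick their exponent by choice. The predicates are equal as functions, so the same
    -- exponent is picked, and its uniqueness is never needed.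
    have hcongr : ∀ {X : Type} {P Q : X → Prop} (f : X → ℂ[T;T⁻¹]), (∀ r, P r ↔ Q r) →
        (if h : ∃ r, P r then f h.choose else 0) = if h : ∃ r, Q r then f h.choose else 0 := by
      intro X P Q f h
      obtain rfl : P = Q := funext fun r => propext (h r)
      rfl
    have hiff : ∀ r : ℤ, push σ.2.isMonic κ = comp σ.1 (twist k r) ↔ κ = twist k r := fun r => by
      rw [comp_twist σ.2.isMonic σ.2.circles_eq_zero, (push_injective σ.2.isMonic).eq_iff]
    unfold coordDiagram twistCoeff
    rw [hcongr _ hiff, hcongr (fun r => _ ^ r) fun r : ℕ => hiff r]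
  · have hne : ∀ r : ℤ, push γ.2.isMonic κ ≠ push σ.2.isMonic (twist k r) := fun r h =>
      hσ (Subtype.ext (γ.2.eq_of_push_eq σ.2 h)).symm
    rw [if_neg hσ]
    simp [coordDiagram, comp_twist σ.2.isMonic σ.2.circles_eq_zero, hne]

theorem T_one_add_T_neg_one_ne_zero :
    (LaurentPolynomial.T 1 + LaurentPolynomial.T (-1) : ℂ[T;T⁻¹]) ≠ 0 := by
  intro h
  -- At x = 1 the value is 2.
  have := congrArg (LaurentPolynomial.eval₂ (RingHom.id ℂ) 1) h
  simp at this

theorem twistCoeff_twist_ne_zero (k r : ℕ) : twistCoeff (twist k r) ≠ 0 := by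
  unfold twistCoeff
  split_ifs with _ h1 h1
  · exact pow_ne_zero _ T_one_add_T_neg_one_ne_zero
  · exact absurd ⟨r, rfl⟩ h1
  · exact (LaurentPolynomial.isUnit_T _).ne_zero
  · exact absurd ⟨(r : ℤ), rfl⟩ h1

/-- The diagram γ ∘ κ sends ρ to γ ∘ (κ ∘ ρ), a multiple of γ in M_k, so only row γ can be nonzero
and its entries depend on κ and ρ alone. -/
theorem rep_single_push (δ : ℂ) {N : ℕ} (k : Index N) (γ : Std k N) (κ : Diagram N k)
    (σ ρ : Std k N) :
    rep δ N (Finsupp.single (push γ.2.isMonic κ) 1) k σ ρ =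
      if σ = γ then δ ^ loops κ ρ.1 • twistCoeff (comp κ ρ.1) else 0 := by
  simp [rep, product, coord, comp_push, loops_push, coordDiagram_push]

end AffineTL

namespace AffineTL

/-! ### Two diagrams whose pairing does not vanish -/

/-- The diagram from `k` to `N = k + 2 p` with the arcs joining the top points `o + 2 a` and
`o + 2 a + 1` for `a < p`, whose other arcs do not cross the cut. -/
def staircase (o p k N : ℕ) (ho : o ≤ k) (hN : N = k + 2 * p) : Diagram k N where
  arc
    | .inl (i, t) =>
      if h1 : i.val < o then .inr (⟨i.val, by omega⟩, t)
      else if h2 : i.val < o + 2 * p then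
        if h3 : (i.val - o) % 2 = 0 then .inl (⟨i.val + 1, by omega⟩, t)
        else .inl (⟨i.val - 1, by omega⟩, t)
      else .inr (⟨i.val - 2 * p, by omega⟩, t)
    | .inr (j, t) =>
      if h1 : j.val < o then .inl (⟨j.val, by omega⟩, t)
      else .inl (⟨j.val + 2 * p, by omega⟩, t)
  arc_arc := by
    rintro (⟨⟨i, hi⟩, t⟩ | ⟨⟨j, hj⟩, t⟩) <;> dsimp only <;> split_ifs <;>
      simp only <;> split_ifs <;> first | omega | (congr 3; omega) | rfl
  arc_ne := by
    rintro (⟨⟨i, hi⟩, t⟩ | ⟨⟨j, hj⟩, t⟩) <;> dsimp only <;> split_ifs <;>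
      (simp; try omega)
  arc_sh := by
    rintro s (⟨⟨i, hi⟩, t⟩ | ⟨⟨j, hj⟩, t⟩) <;> simp only [shE, Sum.map_inl, Sum.map_inr, sh] <;>
      split_ifs <;> rfl
  circles := 0

/-- With positions compared lexicographically by `pos_lt_pos_iff`, the product of turn and `N`
disappears and planarity becomes a finite case check in linear arithmetic. -/
theorem isStandard_staircase (o p k N : ℕ) (ho : o ≤ k) (hN : N = k + 2 * p) :
    IsStandard (staircase o p k N ho hN) := by
  refine ⟨⟨?_, fun h => absurd h (lt_irrefl 0)⟩, ?_, rfl, ?_⟩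
  · rintro ⟨⟨⟨i, hi⟩, t⟩ | ⟨⟨i, hi⟩, t⟩, ⟨⟨j, hj⟩, s⟩ | ⟨⟨j, hj⟩, s⟩, h1, h2, h3⟩ <;>
      simp only [staircase] at h1 h2 h3 <;> split_ifs at h2 h3 <;>
      simp only [Before, pos_lt_pos_iff] at h1 h2 h3 <;> omega
  · rintro ⟨⟨i, hi⟩, t⟩ ⟨⟨j, hj⟩, s⟩
    simp only [staircase]
    split_ifs <;> simp
  · rintro ⟨⟨i, hi⟩, t⟩ ⟨⟨j, hj⟩, s⟩
    simp only [staircase]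
    split_ifs <;> simp only [Sum.inr.injEq, Prod.mk.injEq, false_imp_iff] <;>
      exact fun h => h.2

/-- The diagram from `0` to `N = 2 p` with the arcs joining the top points `2 a + 1` and `2 a + 2`,
the last of them across the cut. -/
def rotatedStaircase (p N : ℕ) (hN : N = 2 * p) : Diagram 0 N where
  arc
    | .inl (i, t) =>
      if h1 : i.val % 2 = 0 then
        if h2 : i.val = 0 then .inl (⟨N - 1, by omega⟩, t - 1)
        else .inl (⟨i.val - 1, by omega⟩, t)
      else
        if h2 : i.val + 1 = N then .inl (⟨0, by omega⟩, t + 1)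
        else .inl (⟨i.val + 1, by omega⟩, t)
    | .inr (j, _) => j.elim0
  arc_arc := by
    rintro (⟨⟨i, hi⟩, t⟩ | ⟨j, t⟩)
    · dsimp only
      split_ifs <;> simp only <;> split_ifs <;> simp only [Sum.inl.injEq, Prod.mk.injEq,
        Fin.mk.injEq, and_true] <;> first | omega | contradiction
    · exact j.elim0
  arc_ne := by
    rintro (⟨⟨i, hi⟩, t⟩ | ⟨j, t⟩)
    · dsimp only
      split_ifs <;> simp only [ne_eq, Sum.inl.injEq, Prod.mk.injEq, Fin.mk.injEq] <;> omega
    · exact j.elim0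
  arc_sh := by
    rintro s (⟨⟨i, hi⟩, t⟩ | ⟨j, t⟩)
    · simp only [shE, Sum.map_inl, sh]
      split_ifs <;> simp only [Sum.map_inl, sh, Sum.inl.injEq, Prod.mk.injEq, true_and] <;> ring
    · exact j.elim0
  circles := 0

theorem isStandard_rotatedStaircase (p N : ℕ) (hN : N = 2 * p) :
    IsStandard (rotatedStaircase p N hN) := by
  refine ⟨⟨?_, fun h => absurd h (lt_irrefl 0)⟩, fun j => j.1.elim0, rfl, fun _ j => j.1.elim0⟩
  rintro ⟨⟨⟨i, hi⟩, t⟩ | ⟨i, t⟩, ⟨⟨j, hj⟩, s⟩ | ⟨j, s⟩, h1, h2, h3⟩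
  · simp only [rotatedStaircase] at h1 h2 h3
    split_ifs at h2 h3 <;> simp only [Before, pos_lt_pos_iff] at h1 h2 h3 <;> omega
  · exact j.elim0
  · exact i.elim0
  · exact i.elim0

section Pairing

variable {k m n : ℕ} {α : Diagram m n} {β : Diagram k m}

theorem Conn.seam_of_upper {p q : Pt m} (h : α.arc (.inr p) = .inr q) :
    Conn α β (seam p) (seam q) :=
  .rel _ _ (Or.inl (congrArg upperEnds h).symm)

theorem Conn.seam_of_lower {p q : Pt m} (h : β.arc (.inl p) = .inl q) :
    Conn α β (seam p) (seam q) :=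
  .rel _ _ (Or.inr (congrArg Sum.inr h).symm)

theorem Conn.top_seam {p : Pt n} {q : Pt m} (h : α.arc (.inl p) = .inr q) :
    Conn α β (outer (.inl p)) (seam q) :=
  .rel _ _ (Or.inl (congrArg upperEnds h).symm)

theorem Conn.bottom_seam {p : Pt k} {q : Pt m} (h : β.arc (.inr p) = .inl q) :
    Conn α β (outer (.inr p)) (seam q) :=
  .rel _ _ (Or.inr (congrArg Sum.inr h).symm)

end Pairing

/-- The arcs 0–1, 2–3, … of the upper diagram and 1–2, 3–4, … of the lower one form a single open
path from 0 to 2p. It belongs to the first through line; the remaining through lines are straight.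
So the composite is the identity and nothing closes up. -/
theorem pairing_staircase (p k N : ℕ) (hk : 1 ≤ k) (hN : N = k + 2 * p) :
    loops (flip (staircase 0 p k N k.zero_le hN)) (staircase 1 p k N hk hN) = 0 ∧
    comp (flip (staircase 0 p k N k.zero_le hN)) (staircase 1 p k N hk hN) =
      twist k (0 : ℕ) := by
  set α := flip (staircase 0 p k N k.zero_le hN) with hα
  set β := staircase 1 p k N hk hN with hβ
  have hzero : ∀ (i : ℕ) (hi : i ≤ 2 * p) (t : ℤ),
      Conn α β (seam (⟨0, by omega⟩, t)) (seam (⟨i, by omega⟩, t)) := by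
    intro i
    induction i with
    | zero => exact fun _ t => .refl _
    | succ i ih =>
      intro hi t
      refine (ih (by omega) t).trans _ _ _ ?_
      by_cases h : i % 2 = 0
      · refine Conn.seam_of_upper ?_
        simp only [hα, flip, staircase, Sum.swap_inr]
        rw [dif_neg (by omega), dif_pos (by omega), dif_pos (by omega)]
        rfl
      · refine Conn.seam_of_lower ?_
        simp only [hβ, staircase]
        rw [dif_neg (by omega), dif_pos (by omega), dif_pos (by omega)]
  have htop : ∀ (j : Fin k) (t : ℤ), Conn α β (outer (.inl (j, t)))
      (seam (⟨j.val + 2 * p, by omega⟩, t)) := by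
    intro j t
    refine Conn.top_seam ?_
    simp only [hα, flip, staircase, Sum.swap_inl]
    rw [dif_neg (by omega)]
    rfl
  have hbot : ∀ (j : Fin k) (t : ℤ), Conn α β (outer (.inr (j, t)))
      (seam (⟨j.val + 2 * p, by omega⟩, t)) := by
    intro j t
    -- Bottom point 0 enters the zigzag at its left end 0 and leaves it at 2p; all other bottom
    -- points reach the seam already shifted by 2p.
    by_cases hj : j.val < 1
    · have h1 : Conn α β (outer (.inr (j, t))) (seam (⟨0, by omega⟩, t)) := by
        refine Conn.bottom_seam ?_
        simp only [hβ, staircase]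
        rw [dif_pos hj]
        congr 3
        omega
      have h2 := h1.trans _ _ _ (hzero (2 * p) le_rfl t)
      have hj0 : (⟨j.val + 2 * p, by omega⟩ : Fin N) = ⟨2 * p, by omega⟩ := by
        rw [Fin.mk.injEq]; omega
      rw [hj0]
      exact h2
    · refine Conn.bottom_seam ?_
      simp only [hβ, staircase]
      rw [dif_neg hj]
  have hopen : ∀ i, ¬ IsClosedCurve α β i := by
    intro i h
    by_cases hi : i.val ≤ 2 * p
    · have h1 := htop ⟨0, hk⟩ 0
      simp only [zero_add] at h1
      exact h (.inl (⟨0, hk⟩, 0)) (((hzero i.val hi 0).symm _ _).trans _ _ _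
        ((hzero (2 * p) le_rfl 0).trans _ _ _ (h1.symm _ _)))
    · refine h (.inl (⟨i.val - 2 * p, by omega⟩, 0)) ?_
      have h1 := (htop ⟨i.val - 2 * p, by omega⟩ 0).symm _ _
      have hi0 : (⟨i.val - 2 * p + 2 * p, by omega⟩ : Fin N) = i := by
        rw [← Fin.val_inj]; simp only; omega
      rw [hi0] at h1
      exact h1
  have hcomp : ∀ (j : Fin k) (t : ℤ), Conn α β (outer (.inl (j, t))) (outer (.inr (j, t))) :=
    fun j t => (htop j t).trans _ _ _ ((hbot j t).symm _ _)
  have htr : ∀ q : Pt k, translate 0 q = q := fun q => pos_injective (by simp [pos_translate])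
  constructor
  · rw [loops, Set.ncard_eq_zero (Set.toFinite _), Set.eq_empty_iff_forall_notMem]
    rintro c ⟨i, -, hi, -⟩
    exact hopen i hi
  · refine Diagram.ext (funext fun q => ?_) ?_
    · rcases q with q | q
      · refine eq_partner (by simp [twist]) ?_
        simp only [twist, Nat.cast_zero, neg_zero, htr]
        exact hcomp q.1 q.2
      · refine eq_partner (by simp [twist]) ?_
        simp only [twist, Nat.cast_zero, htr]
        exact (hcomp q.1 q.2).symm _ _
    · have hn : newCircles α β = 0 := by
        rw [newCircles, Set.ncard_eq_zero (Set.toFinite _), Set.eq_empty_iff_forall_notMem]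
        rintro c ⟨i, -, hi, -⟩
        exact hopen i hi
      change 0 + 0 + newCircles α β = if k = 0 then 0 else 0
      rw [hn, ite_self]

/-- For k = 0 there is no through line to absorb the zigzag. The lower cup across the cut closes it
up around the cylinder instead, so it is not a contractible loop. -/
theorem pairing_rotatedStaircase (p N : ℕ) (hN : N = 0 + 2 * p) :
    loops (flip (staircase 0 p 0 N le_rfl hN)) (rotatedStaircase p N (hN.trans (zero_add _))) = 0 ∧
    ∃ r : ℕ, comp (flip (staircase 0 p 0 N le_rfl hN))
      (rotatedStaircase p N (hN.trans (zero_add _))) = twist 0 r := by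
  set α := flip (staircase 0 p 0 N le_rfl hN) with hα
  set β := rotatedStaircase p N (hN.trans (zero_add _)) with hβ
  have hzero : ∀ (i : ℕ) (hi : i < N) (t : ℤ),
      Conn α β (seam (⟨0, by omega⟩, t)) (seam (⟨i, hi⟩, t)) := by
    intro i
    induction i with
    | zero => exact fun _ t => .refl _
    | succ i ih =>
      intro hi t
      refine (ih (by omega) t).trans _ _ _ ?_
      by_cases h : i % 2 = 0
      · refine Conn.seam_of_upper ?_
        simp only [hα, flip, staircase, Sum.swap_inr]
        rw [dif_neg (by omega), dif_pos (by omega), dif_pos (by omega)]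
        rfl
      · refine Conn.seam_of_lower ?_
        simp only [hβ, rotatedStaircase]
        rw [dif_neg (by omega), dif_neg (by omega)]
  -- On the strip, the cup across the cut joins the last point of one turn to the first point of the
  -- next.
  have hround : ∀ i : Fin N, Conn α β (seam (i, 0)) (seam (i, 1)) := by
    intro i
    have hi := i.isLt
    have h1 : Conn α β (seam (⟨N - 1, by omega⟩, 0)) (seam (⟨0, by omega⟩, 1)) := by
      refine Conn.seam_of_lower ?_
      simp only [hβ, rotatedStaircase]
      rw [dif_neg (by omega), dif_pos (by omega)]
      rfl
    exact ((hzero i.1 i.2 0).symm _ _).trans _ _ _ ((hzero (N - 1) (by omega) 0).trans _ _ _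
      (h1.trans _ _ _ (hzero i.1 i.2 1)))
  constructor
  · rw [loops, Set.ncard_eq_zero (Set.toFinite _), Set.eq_empty_iff_forall_notMem]
    rintro c ⟨i, -, -, hi⟩
    exact one_ne_zero (hi 1 (hround i))
  -- A diagram from 0 to 0 has no arcs, so it is the power of τ_0 given by its number of circles;
  -- that number need not be computed, since every power of x + 1/x is nonzero.
  · refine ⟨(comp α β).circles, Diagram.ext (funext fun q => ?_) ?_⟩
    · rcases q with q | q <;> exact q.1.elim0
    · simp [twist]

theorem exists_pairing_ne_zero (δ : ℂ) {N : ℕ} (k : Index N) :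
    ∃ γ β : Std k N, δ ^ loops (flip γ.1) β.1 • twistCoeff (comp (flip γ.1) β.1) ≠ 0 := by
  obtain ⟨k, hkN, hmod⟩ := k
  obtain ⟨p, hN⟩ : ∃ p, N = k + 2 * p := by
    have : k % 2 = N % 2 := hmod
    exact ⟨(N - k) / 2, by omega⟩
  rcases Nat.eq_zero_or_pos k with rfl | hk
  · obtain ⟨h1, r, h2⟩ := pairing_rotatedStaircase p N hN
    refine ⟨⟨_, isStandard_staircase 0 p 0 N le_rfl hN⟩,
      ⟨_, isStandard_rotatedStaircase p N (hN.trans (zero_add _))⟩, ?_⟩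
    rw [h1, h2, pow_zero, one_smul]
    exact twistCoeff_twist_ne_zero 0 r
  · obtain ⟨h1, h2⟩ := pairing_staircase p k N hk hN
    refine ⟨⟨_, isStandard_staircase 0 p k N k.zero_le hN⟩,
      ⟨_, isStandard_staircase 1 p k N hk hN⟩, ?_⟩
    rw [h1, h2, pow_zero, one_smul]
    exact twistCoeff_twist_ne_zero k 0

/-! ### The commutant -/

/-- A matrix commuting with the rank one matrices whose only nonzero row, in any chosen position,
is a fixed nonzero row, is scalar. -/
theorem eq_scalar_of_commute_row {n R : Type*} [Fintype n] [DecidableEq n] [CommRing R]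
    [IsDomain R] (A : Matrix n n R) (g : n → R) {b : n} (hb : g b ≠ 0)
    (hA : ∀ c, Commute A (Matrix.of fun s r => if s = c then g r else 0)) :
    A = Matrix.scalar n (A b b) := by
  -- Column b of the commutation relation. The right side vanishes off the diagonal and is
  -- independent of c on it, so cancelling g b gives a scalar matrix.
  have key : ∀ c s, A s c * g b = if s = c then ∑ r, g r * A r b else 0 := by
    intro c s
    have h := congrFun (congrFun (hA c).eq s) b
    simp only [Matrix.mul_apply, Matrix.of_apply, mul_ite, mul_zero, Finset.sum_ite_eq',
      Finset.mem_univ, if_true] at h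
    rw [h]
    split_ifs <;> simp
  ext s c
  refine mul_right_cancel₀ hb ?_
  rw [key, Matrix.scalar_apply, Matrix.diagonal_apply]
  split_ifs
  · rw [key, if_pos rfl]
  · rw [zero_mul]

theorem rep_push_flip_mem_image (δ : ℂ) {N : ℕ} (k : Index N) (γ γ' : Std k N) :
    rep δ N (Finsupp.single (push γ.2.isMonic (flip γ'.1)) 1) ∈ image δ N :=
  ⟨_, Submodule.subset_span ⟨_, isAffine_push γ.2.isMonic γ.2.1 (isAffine_flip γ'.2.1)
    γ'.2.circles_eq_zero, rfl⟩, rfl⟩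

theorem centralizer_image (δ : ℂ) (N : ℕ) :
    Set.centralizer (image δ N) = Set.range (scalarEmbedding N) := by
  ext A
  constructor
  · intro hA
    choose γ β hne using fun k : Index N => exists_pairing_ne_zero δ k
    refine ⟨fun k => A k (β k) (β k), funext fun k => ?_⟩
    refine (eq_scalar_of_commute_row (A k)
      (fun ρ => δ ^ loops (flip (γ k).1) ρ.1 • twistCoeff (comp (flip (γ k).1) ρ.1))
      (hne k) fun c => ?_).symm
    -- Products are componentwise, so only component k of the relation is used; what the same
    -- diagram does in the other components is irrelevant.
    have h := congrFun (hA _ (rep_push_flip_mem_image δ k c (γ k))) k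
    have he : rep δ N (Finsupp.single (push c.2.isMonic (flip (γ k).1)) 1) k =
        Matrix.of fun s r => if s = c then
          δ ^ loops (flip (γ k).1) r.1 • twistCoeff (comp (flip (γ k).1) r.1) else 0 :=
      Matrix.ext fun s r => rep_single_push δ k c _ s r
    rw [← he]
    exact h.symm
  · rintro ⟨f, rfl⟩ M -
    exact funext fun k => ((Matrix.scalar_commute (f k) (fun r => Commute.all _ r) (M k)).eq).symm

theorem scalarEmbedding_injective (N : ℕ) : Function.Injective (scalarEmbedding N) := by
  intro f g h
  funext k
  -- Only the existence of a standard diagram matters here, that is d_k > 0; the parameter 0 is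
  -- arbitrary.
  obtain ⟨γ, -⟩ := exists_pairing_ne_zero 0 k
  have : Nonempty (Std k N) := ⟨γ⟩
  exact Matrix.scalar_inj.1 (congrFun h k)

end AffineTL

theorem mainTheorem5 (N : ℕ) (δ : ℂ) :
    Set.centralizer (AffineTL.image δ N) = Set.range (AffineTL.scalarEmbedding N) ∧
      Function.Injective (AffineTL.scalarEmbedding N) :=
  ⟨AffineTL.centralizer_image δ N, AffineTL.scalarEmbedding_injective N⟩
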